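/- **Theorem (equivalence of all additive adversaries).** There is a polynomial $p$ in three variables such that the following holds. Let $X$ be a finite set, $n\in\mathbb N$, $f:X^n\to\{0,1\}$, $\mathcal D$ a probability distribution on $X$, and $\eta,\varepsilon\in(0,1)$. Let $m$ be any integer with $m\ge p(n,1/\varepsilon,\ln|X|)$. Then $m\ge n$. Let $\Phi_{m\to n}$ be the subsampling filter, which maps $S\in X^m$ to a tuple of $n$ points drawn uniformly without replacement from $S$, and let $f'=f\circ\Phi_{m\to n}:X^m\to\{0,1\}$ (a randomized function). Then any two of the following four quantities differ by at most $\varepsilon$. 1. *Oblivious additive adversary:* $\displaystyle\sup_{\mathcal E}\ \mathbb E_{S\sim((1-\eta)\mathcal D+\eta\mathcal E)^n}[f(S)]$, the supremum being over all distributions $\mathcal E$ on $X$. 2. *Adaptive additive adversary:* $\displaystyle\mathbb E_{S\sim\mathcal D^{\lceil(1-\eta)m\rceil}}\Big[\sup_{S'}\mathbb E[f'(S')]\Big]$, the supremum being over all $S'\in X^m$ formed by adding $\lfloor\eta m\rfloor$ arbitrary points to $S$ and then arbitrarily permuting the $m$ points. 3. *Malicious noise:* the supremum of $\mathbb E[f'(x_1,\dots,x_m)]$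 over all adversaries in the following process. For $i=1,\dots,m$ in turn, an independent coin with heads probability $\eta$ is flipped; on tails $x_i$ is drawn from $\mathcal D$, independently of the past; on heads the adversary chooses $x_i\in X$ arbitrarily (possibly at random), with full knowledge of $x_1,\dots,x_{i-1}$ but no knowledge of the future points. 4. *Non-i.i.d. adversary:* the supremum of the expected value of $f'$ over all samples of size $m$ generated as follows. The adversary first chooses $\lfloor\eta m\rfloor$ arbitrary points of $X$ (possibly at random); then $\lceil(1-\eta)m\rceil$ points are drawn i.i.d. from $\mathcal D$, independently of the adversary's points, and added to them; and the $m$ points are permuted arbitrarily. -/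

import Mathlib

open scoped ENNReal

noncomputable section

namespace AdditiveAdversary

variable {X : Type*}

/-! Samples in `X ^ k` are tuples `Fin k → X`; distributions are probability mass functions.
A (possibly randomized) map `X ^ k → {0, 1}` is a function `(Fin k → X) → PMF Bool`, where `true`
stands for `1`. -/

/-- The `η`-coin: heads (`true`) with probability `η`, tails (`false`) with probability `1 - η`. -/
def coin (η : unitInterval) : PMF Bool :=
  PMF.ofFintype (fun b => if b then ENNReal.ofReal η else ENNReal.ofReal (1 - η)) (by
    rw [Fintype.sum_bool]
    simp only [if_true, Bool.false_eq_true, if_false]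
    rw [← ENNReal.ofReal_add η.2.1 (sub_nonneg.2 η.2.2)]
    simp)

/-- The mixture `(1 - η) D + η E`. -/
def mix (η : unitInterval) (D E : PMF X) : PMF X :=
  (coin η).bind fun heads => if heads then E else D

theorem mix_apply (η : unitInterval) (D E : PMF X) (x : X) :
    mix η D E x = ENNReal.ofReal (1 - η) * D x + ENNReal.ofReal η * E x := by
  simp [mix, coin, PMF.bind_apply, tsum_fintype, add_comm]

/-- The product distribution `D ^ k` of `k` independent draws from `D`. -/
def iid [Fintype X] (D : PMF X) (k : ℕ) : PMF (Fin k → X) :=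
  PMF.ofFintype (fun S => ∏ i, D (S i)) (by
    classical
    have h : ∑ x, D x = 1 := (tsum_fintype (fun x => D x)).symm.trans D.tsum_coe
    rw [← Fintype.piFinset_univ, ← Finset.prod_univ_sum]
    simp [h])

/-- The probability that the randomized map `A` outputs `1` on a sample with law `μ`,
i.e. the expected value of `A` on that sample. -/
def successProb {k : ℕ} (μ : PMF (Fin k → X)) (A : (Fin k → X) → PMF Bool) : ℝ :=
  (μ.bind A true).toReal

/-- A deterministic `f : X ^ k → {0, 1}` as a randomized one. -/
def deterministic {k : ℕ} (f : (Fin k → X) → Bool) : (Fin k → X) → PMF Bool :=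
  fun S => PMF.pure (f S)

/-- The subsampling filter `Φ_{m → n}`: a tuple of `n` points drawn uniformly without replacement
from the sample `S`, i.e. the entries of `S` at a uniformly random injective `n`-tuple of
positions. -/
def subsample {n m : ℕ} (h : n ≤ m) (S : Fin m → X) : PMF (Fin n → X) :=
  haveI : Nonempty (Fin n ↪ Fin m) := ⟨Fin.castLEEmb h⟩
  (PMF.uniformOfFintype (Fin n ↪ Fin m)).map fun e => S ∘ e

/-- The randomized map `f ∘ Φ_{m → n} : X ^ m → {0, 1}`. -/
def compSubsample {n m : ℕ} (f : (Fin n → X) → Bool) (h : n ≤ m) : (Fin m → X) → PMF Bool :=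
  fun S => (subsample h S).map f

/-! ### The oblivious additive adversary -/

/-- `add_η(D)`: all distributions `(1 - η) D + η E`. -/
def addDist (η : unitInterval) (D : PMF X) : Set (PMF X) :=
  {D' | ∃ E : PMF X, D' = mix η D E}

/-- Maximum success probability in the presence of the oblivious additive adversary. -/
def obliviousAddMax [Fintype X] (η : unitInterval) {k : ℕ} (A : (Fin k → X) → PMF Bool)
    (D : PMF X) : ℝ :=
  ⨆ D' : addDist η D, successProb (iid (D' : PMF X) k) A

/-! ### The adaptive additive adversary -/

/-- The number `⌈(1 - η) m⌉` of clean points in a sample of size `m`. -/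
def numClean (η : unitInterval) (m : ℕ) : ℕ := ⌈(1 - (η : ℝ)) * m⌉₊

/-- The number `⌊η m⌋` of added points in a sample of size `m`. -/
def numAdded (η : unitInterval) (m : ℕ) : ℕ := ⌊(η : ℝ) * m⌋₊

/-- The sample of size `m` made of the points of `S` and the points of `T`, in the order
given by `σ`. -/
def combine {m a b : ℕ} (S : Fin a → X) (T : Fin b → X) (σ : Fin m ≃ Fin a ⊕ Fin b) :
    Fin m → X :=
  fun i => Sum.elim S T (σ i)

/-- `add_η(S)`: all samples of size `m` formed by adding `⌊η m⌋` points to `S` and then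
arbitrarily permuting. -/
def addSample (η : unitInterval) (m : ℕ) (S : Fin (numClean η m) → X) : Set (Fin m → X) :=
  {S' | ∃ (T : Fin (numAdded η m) → X)
      (σ : Fin m ≃ Fin (numClean η m) ⊕ Fin (numAdded η m)), S' = combine S T σ}

/-- Maximum success probability in the presence of the adaptive additive adversary: the expectation
over a clean sample `S` from `D ^ ⌈(1 - η) m⌉` of the supremum over `S' ∈ add_η(S)` of the
expected value of `A` on `S'`. -/
def adaptiveAddMax [Fintype X] (η : unitInterval) {m : ℕ} (A : (Fin m → X) → PMF Bool)
    (D : PMF X) : ℝ :=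
  ∑ S : Fin (numClean η m) → X,
    (iid D (numClean η m) S).toReal * ⨆ S' : addSample η m S, (A S' true).toReal

/-! ### Malicious noise -/

/-- A strategy of the malicious adversary: the (possibly random) choice of the next point as a
function of all the points generated so far. Letting it also depend on earlier coins or on earlier
private randomness would not enlarge the set of laws of the generated samples, because the
conditional law of that choice given the earlier points is again a strategy of this form. -/
abbrev MalStrategy (X : Type*) := (i : ℕ) → (Fin i → X) → PMF X

/-- The law of the sample of size `k` that is generated sequentially under malicious noise: at each
step an `η`-coin is flipped; on heads the adversary chooses the next point, on tails it is drawn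
from `D`. -/
def malSample (η : unitInterval) (D : PMF X) (s : MalStrategy X) : (k : ℕ) → PMF (Fin k → X)
  | 0 => PMF.pure Fin.elim0
  | k + 1 => (malSample η D s k).bind fun S =>
      (coin η).bind fun heads =>
        (if heads then s k S else D).map fun x => (Fin.snoc S x : Fin (k + 1) → X)

/-- Maximum success probability in the presence of the malicious adversary. -/
def malMax (η : unitInterval) {m : ℕ} (A : (Fin m → X) → PMF Bool) (D : PMF X) : ℝ :=
  ⨆ s : MalStrategy X, successProb (malSample η D s m) A

/-! ### The non-iid adversary -/

/-- A strategy of the non-iid adversary: the (possibly random) choice of `⌊η m⌋` points, made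
without any knowledge of the clean points, and a rule by which the `m` points are permuted once
all of them are generated. -/
structure NonIidStrategy (X : Type*) (η : unitInterval) (m : ℕ) where
  points : PMF (Fin (numAdded η m) → X)
  order : (Fin (numClean η m) → X) → (Fin (numAdded η m) → X) →
    (Fin m ≃ Fin (numClean η m) ⊕ Fin (numAdded η m))

/-- The law of the sample of size `m` generated by a non-iid adversary: the adversary's points `T`
are chosen first, then the clean points `S` are drawn independently of them from
`D ^ ⌈(1 - η) m⌉`, and the two are combined and permuted. -/
def nonIidSample [Fintype X] {η : unitInterval} {m : ℕ} (D : PMF X) (s : NonIidStrategy X η m) :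
    PMF (Fin m → X) :=
  s.points.bind fun T => (iid D (numClean η m)).map fun S => combine S T (s.order S T)

/-- Maximum success probability in the presence of the non-iid adversary. -/
def nonIidMax [Fintype X] (η : unitInterval) {m : ℕ} (A : (Fin m → X) → PMF Bool)
    (D : PMF X) : ℝ :=
  ⨆ s : NonIidStrategy X η m, successProb (nonIidSample D s) A

end AdditiveAdversary

end

/-!
All four quantities are compared with the oblivious one. Two adversaries dominate it for trivial
reasons. A malicious adversary may always answer with a draw from a fixed distribution `E`, which
makes the sample i.i.d. from `(1 - η) D + η E`, and distinct positions of an i.i.d. sample are again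
i.i.d. (`obliviousAddMax_le_malMax`). A non-i.i.d. adversary may draw the added points from `E`; the
subsample is then that of the oblivious adversary up to a collision probability and the rounding of
`η m` (`obliviousAddMax_le_nonIidMax`). The adaptive adversary dominates the non-i.i.d. one
(`nonIidMax_le_adaptiveAddMax`).

For the converse, both the adaptive and the malicious adversary are subsumed by one who sees a
random sample with open positions and fills them knowing all of it (`prodExpect_fill_le`). A union
bound over the `|X| ^ (η m)` ways to fill them would be too expensive. However, `f` reads only `n`
points, so that the added points may be replaced by draws from a list of `k`, about `n ^ 2 / ε`, of
them (`exists_prodExpect_le_sample`). This leaves `|X| ^ k` oblivious adversaries. The success of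
each of them is a function of the random sample that changes by at most `2 n / m` when one point
changes, so its exponential moments are those of a concentrated variable (`prodExpect_exp_le`), and
the expected maximum over all `|X| ^ k` lists exceeds the maximal expectation by little as soon as
`m` is large compared with `n ^ 2 k log |X| / ε ^ 2` (`prodExpect_le_of_forall_exists_le`). The expectation for a
fixed list is, up to errors as above, the success of the oblivious adversary whose `E` is uniform on
that list.

Laws are handled as real weight functions, in which `prodExpect` is multilinear: this makes
mixtures (`prodExpect_mixture`), marginals (`prodExpect_comp_injective`) and Lipschitz bounds
(`abs_prodExpect_sub_le`) elementary.
-/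

namespace AdditiveAdversary

/-! ### Expectations under product weights -/

section ProdExpect

variable {Ω ι : Type*} [Fintype Ω] [Fintype ι] {k n : ℕ}

/-- The expectation of `g (w 0, …, w (k - 1))` when the coordinates `w i` are independent and
`w i` has law `P i`. The laws are plain weight functions, so that the expression is multilinear
in them. -/
noncomputable def prodExpect (P : Fin k → Ω → ℝ) (g : (Fin k → Ω) → ℝ) : ℝ :=
  ∑ w, (∏ i, P i (w i)) * g w

theorem prodExpect_mono {P : Fin k → Ω → ℝ} (hP : ∀ i x, 0 ≤ P i x) {g h : (Fin k → Ω) → ℝ}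
    (hgh : ∀ w, g w ≤ h w) : prodExpect P g ≤ prodExpect P h :=
  Finset.sum_le_sum fun w _ =>
    mul_le_mul_of_nonneg_left (hgh w) (Finset.prod_nonneg fun i _ => hP i _)

theorem prodExpect_const {P : Fin k → Ω → ℝ} (hP : ∀ i, ∑ x, P i x = 1) (c : ℝ) :
    prodExpect P (fun _ => c) = c := by
  classical
  rw [prodExpect, ← Finset.sum_mul, ← Fintype.piFinset_univ, ← Finset.prod_univ_sum]
  simp [hP]

theorem prodExpect_add (P : Fin k → Ω → ℝ) (g h : (Fin k → Ω) → ℝ) :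
    prodExpect P (fun w => g w + h w) = prodExpect P g + prodExpect P h := by
  simp only [prodExpect, mul_add, Finset.sum_add_distrib]

theorem prodExpect_sub (P : Fin k → Ω → ℝ) (g h : (Fin k → Ω) → ℝ) :
    prodExpect P (fun w => g w - h w) = prodExpect P g - prodExpect P h := by
  simp only [prodExpect, mul_sub, Finset.sum_sub_distrib]

theorem prodExpect_mul_left (P : Fin k → Ω → ℝ) (c : ℝ) (g : (Fin k → Ω) → ℝ) :
    prodExpect P (fun w => c * g w) = c * prodExpect P g := by
  simp only [prodExpect, Finset.mul_sum]
  exact Finset.sum_congr rfl fun _ _ => by ring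

theorem prodExpect_sum (P : Fin k → Ω → ℝ) (g : ι → (Fin k → Ω) → ℝ) :
    prodExpect P (fun w => ∑ i, g i w) = ∑ i, prodExpect P (g i) := by
  simp only [prodExpect, Finset.mul_sum]
  exact Finset.sum_comm

theorem prodExpect_nonneg {P : Fin k → Ω → ℝ} (hP : ∀ i x, 0 ≤ P i x) {g : (Fin k → Ω) → ℝ}
    (hg : ∀ w, 0 ≤ g w) : 0 ≤ prodExpect P g :=
  Finset.sum_nonneg fun w _ => mul_nonneg (Finset.prod_nonneg fun i _ => hP i _) (hg w)

theorem prodExpect_mem_Icc {P : Fin k → Ω → ℝ} (hP : ∀ i, P i ∈ stdSimplex ℝ Ω)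
    {g : (Fin k → Ω) → ℝ} (hg : ∀ w, g w ∈ Set.Icc (0 : ℝ) 1) :
    prodExpect P g ∈ Set.Icc (0 : ℝ) 1 :=
  ⟨prodExpect_nonneg (fun i => (hP i).1) fun w => (hg w).1,
    (prodExpect_mono (fun i => (hP i).1) fun w => (hg w).2).trans_eq
      (prodExpect_const (fun i => (hP i).2) 1)⟩

/-- Some sample is at least as good as the average. -/
theorem exists_prodExpect_le {P : Fin k → Ω → ℝ} (hP : ∀ i, P i ∈ stdSimplex ℝ Ω)
    (g : (Fin k → Ω) → ℝ) : ∃ w, prodExpect P g ≤ g w := by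
  by_contra! h
  have hlt : ∑ w : Fin k → Ω, (∏ i, P i (w i)) * g w <
      ∑ w : Fin k → Ω, (∏ i, P i (w i)) * prodExpect P g := by
    have h1 : ∑ w : Fin k → Ω, (∏ i, P i (w i)) = 1 := by
      simpa [prodExpect] using prodExpect_const (fun i => (hP i).2) 1
    have h0 : ∀ w : Fin k → Ω, 0 ≤ ∏ i, P i (w i) :=
      fun w => Finset.prod_nonneg fun i _ => (hP i).1 _
    obtain ⟨w, -, hw⟩ := Finset.exists_ne_zero_of_sum_ne_zero (h1.trans_ne one_ne_zero)
    exact Finset.sum_lt_sum (fun v _ => mul_le_mul_of_nonneg_left (h v).le (h0 v))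
      ⟨w, Finset.mem_univ _, mul_lt_mul_of_pos_left (h w) (lt_of_le_of_ne (h0 w) hw.symm)⟩
  have := prodExpect_const (fun i => (hP i).2) (prodExpect P g)
  rw [prodExpect] at this
  rw [this] at hlt
  exact lt_irrefl _ hlt

theorem prodExpect_succ (P : Fin (k + 1) → Ω → ℝ) (g : (Fin (k + 1) → Ω) → ℝ) :
    prodExpect P g = prodExpect (fun i => P i.castSucc)
      (fun w => ∑ x, P (Fin.last k) x * g (Fin.snoc w x : Fin (k + 1) → Ω)) := by
  rw [prodExpect, ← (Fin.snocEquiv fun _ => Ω).sum_comp, Fintype.sum_prod_type_right]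
  refine Finset.sum_congr rfl fun w _ => ?_
  rw [Finset.mul_sum]
  refine Finset.sum_congr rfl fun x _ => ?_
  simp [Fin.snocEquiv, Fin.prod_univ_castSucc, mul_assoc]

/-- Drawing each coordinate from a mixture is drawing the mixture components first. -/
theorem prodExpect_mixture (α : Fin k → ι → ℝ) (P : Fin k → ι → Ω → ℝ) (g : (Fin k → Ω) → ℝ) :
    prodExpect (fun j x => ∑ i, α j i * P j i x) g =
      prodExpect α (fun e => prodExpect (fun j => P j (e j)) g) := by
  classical
  have h : ∀ x : Fin k → Ω, ∏ j, ∑ i, α j i * P j i (x j) =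
      ∑ e : Fin k → ι, ∏ j, α j (e j) * P j (e j) (x j) := fun x => by
    rw [Finset.prod_univ_sum, Fintype.piFinset_univ]
  simp only [prodExpect, h, Finset.sum_mul, Finset.mul_sum, Finset.prod_mul_distrib]
  rw [Finset.sum_comm]
  exact Finset.sum_congr rfl fun _ _ => Finset.sum_congr rfl fun _ _ => by ring

theorem prodExpect_pi_single [DecidableEq Ω] (y : Fin k → Ω) (g : (Fin k → Ω) → ℝ) :
    prodExpect (fun j => Pi.single (y j) 1) g = g y := by
  rw [prodExpect, Finset.sum_eq_single y]
  · simp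
  · intro w _ hw
    obtain ⟨i, hi⟩ := Function.ne_iff.1 hw
    rw [Finset.prod_eq_zero (Finset.mem_univ i) (by simp [hi]), zero_mul]
  · simp

/-- The marginal of a product law along distinct coordinates is the product of the
corresponding factors. -/
theorem prodExpect_comp_injective {P : Fin k → Ω → ℝ} (hP : ∀ i, ∑ x, P i x = 1)
    {u : Fin n → Fin k} (hu : Function.Injective u) (g : (Fin n → Ω) → ℝ) :
    prodExpect P (fun w => g (w ∘ u)) = prodExpect (fun j => P (u j)) g := by
  classical
  have key : ∀ q : Fin n → Ω,
      ∑ w : Fin k → Ω, (∏ i, P i (w i)) * (if w ∘ u = q then 1 else 0) =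
        ∏ j, P (u j) (q j) := by
    intro q
    have h1 : ∀ w : Fin k → Ω, (∏ i, P i (w i)) * (if w ∘ u = q then 1 else 0) =
        ∏ i, P i (w i) * (if ∀ j, u j = i → w i = q j then 1 else 0) := by
      intro w
      rw [Finset.prod_mul_distrib, Finset.prod_ite_zero]
      congr 1
      simp only [funext_iff, Function.comp_apply, Finset.mem_univ, true_imp_iff,
        Finset.prod_const_one]
      refine if_congr ⟨?_, fun h j => h _ j rfl⟩ rfl rfl
      rintro h _ j rfl
      exact h j
    simp only [h1]
    rw [← Fintype.piFinset_univ, ← Finset.prod_univ_sum (fun _ => Finset.univ)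
      (fun i x => P i x * (if ∀ j, u j = i → x = q j then 1 else 0))]
    symm
    refine Fintype.prod_of_injective u hu _ _ (fun i hi => ?_) (fun j => ?_)
    · have : ∀ x, ∀ j, u j = i → x = q j := fun x j hj => absurd ⟨j, hj⟩ hi
      simp only [if_pos (this _), mul_one, hP]
    · have : ∀ x, (∀ j', u j' = u j → x = q j') ↔ x = q j :=
        fun x => ⟨fun h => h j rfl, fun h j' hj' => by rw [hu hj', h]⟩
      simp [this]
  calc prodExpect P (fun w => g (w ∘ u))
      = ∑ w : Fin k → Ω, ∑ q : Fin n → Ω,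
          ((∏ i, P i (w i)) * (if w ∘ u = q then 1 else 0)) * g q := by
        refine Finset.sum_congr rfl fun w _ => ?_
        simp
    _ = _ := by
        rw [Finset.sum_comm]
        simp only [← Finset.sum_mul, key]
        rfl

/-- The `k`-fold product law is `k`-Lipschitz in its factor, for the `ℓ¹` distance. -/
theorem abs_prodExpect_sub_le {p q : Ω → ℝ} (hp : p ∈ stdSimplex ℝ Ω) (hq : q ∈ stdSimplex ℝ Ω)
    {g : (Fin k → Ω) → ℝ} (hg : ∀ w, g w ∈ Set.Icc (0 : ℝ) 1) :
    |prodExpect (fun _ => p) g - prodExpect (fun _ => q) g| ≤ k * ∑ x, |p x - q x| := by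
  induction k with
  | zero => simp [prodExpect]
  | succ k ih =>
    rw [prodExpect_succ (fun _ => p), prodExpect_succ (fun _ => q)]
    set a : (Fin k → Ω) → ℝ := fun w => ∑ x, p x * g (Fin.snoc w x : Fin (k + 1) → Ω)
    set b : (Fin k → Ω) → ℝ := fun w => ∑ x, q x * g (Fin.snoc w x : Fin (k + 1) → Ω)
    have ha : ∀ w, a w ∈ Set.Icc (0 : ℝ) 1 := fun w =>
      ⟨Finset.sum_nonneg fun x _ => mul_nonneg (hp.1 x) (hg _).1,
        (Finset.sum_le_sum fun x _ => mul_le_of_le_one_right (hp.1 x) (hg _).2).trans_eq hp.2⟩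
    have hab : ∀ w, |a w - b w| ≤ ∑ x, |p x - q x| := fun w => by
      rw [← Finset.sum_sub_distrib]
      refine (Finset.abs_sum_le_sum_abs _ _).trans (Finset.sum_le_sum fun x _ => ?_)
      rw [← sub_mul, abs_mul]
      refine mul_le_of_le_one_right (abs_nonneg _) ?_
      rw [abs_of_nonneg (hg _).1]
      exact (hg _).2
    have h1 := ih ha
    have h2 : |prodExpect (fun _ : Fin k => q) a - prodExpect (fun _ => q) b| ≤
        ∑ x, |p x - q x| := by
      have hc := prodExpect_const (k := k) (P := fun _ => q) (fun _ => hq.2)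
      have hm := fun u v => prodExpect_mono (k := k) (P := fun _ => q) (fun _ => hq.1)
        (g := u) (h := v)
      rw [← prodExpect_sub, abs_le]
      constructor
      · rw [← hc (-∑ x, |p x - q x|)]
        exact hm _ _ fun w => (abs_le.1 (hab w)).1
      · rw [← hc (∑ x, |p x - q x|)]
        exact hm _ _ fun w => (abs_le.1 (hab w)).2
    push_cast
    rw [add_mul, one_mul]
    exact (abs_sub_le _ _ _).trans (add_le_add h1 h2)

end ProdExpect

/-! ### Sampling without replacement -/

section Embedding

variable {n m : ℕ}

/-- The average of `h` over all injective `n`-tuples of positions in `Fin m`. -/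
noncomputable def embAvg (n m : ℕ) (h : (Fin n → Fin m) → ℝ) : ℝ :=
  (∑ e : Fin n ↪ Fin m, h e) / Fintype.card (Fin n ↪ Fin m)

theorem card_emb_pos (hnm : n ≤ m) : (0 : ℝ) < Fintype.card (Fin n ↪ Fin m) := by
  have : Nonempty (Fin n ↪ Fin m) := ⟨Fin.castLEEmb hnm⟩
  exact_mod_cast Fintype.card_pos

theorem embAvg_const (hnm : n ≤ m) (c : ℝ) : embAvg n m (fun _ => c) = c := by
  have := card_emb_pos hnm
  simp only [embAvg, Finset.sum_const, Finset.card_univ, nsmul_eq_mul]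
  field_simp

theorem embAvg_congr {h h' : (Fin n → Fin m) → ℝ}
    (hh : ∀ e, Function.Injective e → h e = h' e) : embAvg n m h = embAvg n m h' := by
  unfold embAvg
  rw [Finset.sum_congr rfl fun (e : Fin n ↪ Fin m) _ => hh e e.injective]

theorem prodExpect_embAvg {Ω : Type*} [Fintype Ω] {k : ℕ} (P : Fin k → Ω → ℝ)
    (h : (Fin k → Ω) → (Fin n → Fin m) → ℝ) :
    prodExpect P (fun w => embAvg n m (h w)) = embAvg n m (fun e => prodExpect P (h · e)) := by
  simp only [embAvg, div_eq_inv_mul]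
  rw [prodExpect_mul_left, prodExpect_sum]

theorem one_sub_le_descFactorial_div (hnm : n ≤ m) (hm : 0 < m) :
    1 - (n : ℝ) ^ 2 / m ≤ (m.descFactorial n : ℝ) / (m : ℝ) ^ n := by
  rcases Nat.eq_zero_or_pos n with rfl | hn
  · simp
  have hm' : (0 : ℝ) < m := by exact_mod_cast hm
  have hn' : (1 : ℝ) ≤ n := by exact_mod_cast hn
  have hnm' : (n : ℝ) ≤ m := by exact_mod_cast hnm
  have h1 : ((m + 1 - n : ℕ) : ℝ) ^ n ≤ m.descFactorial n := by
    exact_mod_cast Nat.pow_sub_le_descFactorial m n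
  rw [Nat.cast_sub (by omega)] at h1
  push_cast at h1
  have h2 : 1 + (n : ℝ) * (-((n - 1) / m)) ≤ (1 + -((n - 1) / m)) ^ n := by
    refine one_add_mul_le_pow ?_ n
    have : ((n : ℝ) - 1) / m ≤ 1 := by rw [div_le_one hm']; linarith
    linarith
  have h3 : (1 + -(((n : ℝ) - 1) / m)) ^ n = (m + 1 - n) ^ n / m ^ n := by
    rw [← div_pow]
    congr 1
    field_simp
    ring
  rw [h3] at h2
  refine le_trans ?_ (h2.trans (div_le_div_of_nonneg_right h1 (by positivity)))
  have : (n : ℝ) * ((n - 1) / m) ≤ n ^ 2 / m := by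
    rw [mul_div_assoc']
    gcongr
    nlinarith
  linarith

/-- Sampling with and without replacement differ by the probability of a collision. -/
theorem abs_embAvg_sub_prodExpect_le (hnm : n ≤ m) (hm : 0 < m) {h : (Fin n → Fin m) → ℝ}
    (hh : ∀ e, h e ∈ Set.Icc (0 : ℝ) 1) :
    |embAvg n m h - prodExpect (fun _ _ => (m : ℝ)⁻¹) h| ≤ (n : ℝ) ^ 2 / m := by
  classical
  have hK := card_emb_pos hnm
  have hp : ∀ g : (Fin n → Fin m) → ℝ,
      prodExpect (fun _ _ => (m : ℝ)⁻¹) g = (∑ e, g e) / (m : ℝ) ^ n := fun g => by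
    simp [prodExpect, ← Finset.mul_sum, div_eq_inv_mul]
  have hinj : ∀ g : (Fin n → Fin m) → ℝ,
      ∑ e : Fin n ↪ Fin m, g e = ∑ e with Function.Injective e, g e := fun g => by
    rw [← (Equiv.subtypeInjectiveEquivEmbedding (Fin n) (Fin m)).sum_comp]
    exact (Finset.sum_subtype _ (by simp) g).symm
  have hsplit : ∀ g : (Fin n → Fin m) → ℝ, ∑ e, g e =
      ∑ e : Fin n ↪ Fin m, g e + ∑ e with ¬ Function.Injective e, g e := fun g => by
    rw [hinj, Finset.sum_filter_add_sum_filter_not]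
  have hdf := one_sub_le_descFactorial_div hnm hm
  rw [embAvg, hp, hsplit h]
  have hone := hsplit fun _ => 1
  simp only [Finset.sum_const, Finset.card_univ, nsmul_eq_mul, mul_one, Fintype.card_pi,
    Fintype.card_fin, Finset.prod_const] at hone
  have hcard : (Fintype.card (Fin n ↪ Fin m) : ℝ) = m.descFactorial n := by
    rw [Fintype.card_embedding_eq]; simp
  rw [← hcard] at hdf
  set K : ℝ := (Fintype.card (Fin n ↪ Fin m) : ℝ)
  set S := ∑ e : Fin n ↪ Fin m, h e
  set R := ∑ e with ¬ Function.Injective e, h e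
  have hS0 : 0 ≤ S := Finset.sum_nonneg fun e _ => (hh e).1
  have hSK : S ≤ K := by
    refine (Finset.sum_le_sum fun (e : Fin n ↪ Fin m) _ => (hh e).2).trans_eq ?_
    simp [K]
  have hR0 : 0 ≤ R := Finset.sum_nonneg fun e _ => (hh e).1
  have hRM : R ≤ (m : ℝ) ^ n - K := by
    have : R ≤ ∑ e : Fin n → Fin m with ¬ Function.Injective e, (1 : ℝ) :=
      Finset.sum_le_sum fun e _ => (hh e).2
    simp only [Finset.sum_const, nsmul_eq_mul, mul_one] at this
    push_cast at hone
    linarith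
  have hM : (0 : ℝ) < (m : ℝ) ^ n := by positivity
  set M : ℝ := (m : ℝ) ^ n
  have hKM : K / M ≤ 1 := by rw [div_le_one hM]; linarith
  have h1 : S / K - (S + R) / M = S / K * (1 - K / M) - R / M := by field_simp; ring
  have h2 : R / M ≤ 1 - K / M := by
    rw [div_le_iff₀ hM, sub_mul, div_mul_cancel₀ _ hM.ne', one_mul]; exact hRM
  have h3 : S / K ≤ 1 := by rw [div_le_one hK]; exact hSK
  have h4 : 0 ≤ S / K := by positivity
  have h5 : 0 ≤ R / M := by positivity
  rw [h1, abs_le]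
  constructor <;> nlinarith

/-- **Sparsification.** A product law `V ^ n` may be replaced by sampling with replacement from a
suitable list of `k` points. -/
theorem exists_prodExpect_le_sample {Ω : Type*} [Fintype Ω] {k : ℕ} (hnk : n ≤ k) (hk : 0 < k)
    {V : Ω → ℝ} (hV : V ∈ stdSimplex ℝ Ω) {h : (Fin n → Ω) → ℝ}
    (hh : ∀ t, h t ∈ Set.Icc (0 : ℝ) 1) :
    ∃ T : Fin k → Ω, prodExpect (fun _ => V) h ≤
      prodExpect (fun _ _ => (k : ℝ)⁻¹) (fun u => h (T ∘ u)) + (n : ℝ) ^ 2 / k := by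
  obtain ⟨T, hT⟩ := exists_prodExpect_le (k := k) (P := fun _ => V) (fun _ => hV)
    (fun T => embAvg n k fun u => h (T ∘ u))
  refine ⟨T, ?_⟩
  rw [prodExpect_embAvg, embAvg_congr (h' := fun _ => prodExpect (fun _ => V) h)
    (fun u hu => prodExpect_comp_injective (fun _ => hV.2) hu h), embAvg_const hnk] at hT
  have := (abs_le.1 (abs_embAvg_sub_prodExpect_le hnk hk fun u => hh (T ∘ u))).2
  linarith

end Embedding

/-! ### Maxima of functions with bounded differences -/

section Concentration

variable {Ω : Type*} [Fintype Ω] {k : ℕ}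

theorem sum_mul_exp_le {p : Ω → ℝ} (hp : p ∈ stdSimplex ℝ Ω) {a : Ω → ℝ} {c t : ℝ}
    (ha : ∀ x y, |a x - a y| ≤ c) (ht : 0 ≤ t) (htc : t * c ≤ 1) :
    ∑ x, p x * Real.exp (t * a x) ≤ Real.exp (t * ∑ x, p x * a x + t ^ 2 * c ^ 2) := by
  set b := ∑ x, p x * a x with hb
  have hdev : ∀ x, |a x - b| ≤ c := by
    intro x
    have : a x - b = ∑ y, p y * (a x - a y) := by
      simp only [mul_sub, Finset.sum_sub_distrib, ← Finset.sum_mul, hp.2, one_mul, hb]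
    rw [this]
    refine (Finset.abs_sum_le_sum_abs _ _).trans ?_
    calc ∑ y, |p y * (a x - a y)| ≤ ∑ y, p y * c := Finset.sum_le_sum fun y _ => by
            rw [abs_mul, abs_of_nonneg (hp.1 y)]
            exact mul_le_mul_of_nonneg_left (ha x y) (hp.1 y)
      _ = c := by rw [← Finset.sum_mul, hp.2, one_mul]
  have hexp : ∀ x, Real.exp (t * (a x - b)) ≤ 1 + t * (a x - b) + t ^ 2 * c ^ 2 := by
    intro x
    have h1 : |t * (a x - b)| ≤ t * c := by
      rw [abs_mul, abs_of_nonneg ht]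
      exact mul_le_mul_of_nonneg_left (hdev x) ht
    have h2 := (abs_le.1 (Real.abs_exp_sub_one_sub_id_le (h1.trans htc))).2
    have h3 : (t * (a x - b)) ^ 2 ≤ (t * c) ^ 2 := by
      rw [← sq_abs]
      exact pow_le_pow_left₀ (abs_nonneg _) h1 2
    rw [mul_pow t c] at h3
    linarith
  have hfac : ∀ x, p x * Real.exp (t * a x) =
      Real.exp (t * b) * (p x * Real.exp (t * (a x - b))) := fun x => by
    rw [mul_left_comm, ← Real.exp_add]
    ring_nf
  simp only [hfac]
  rw [← Finset.mul_sum, Real.exp_add]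
  refine mul_le_mul_of_nonneg_left ?_ (Real.exp_pos _).le
  calc ∑ x, p x * Real.exp (t * (a x - b))
      ≤ ∑ x, p x * (1 + t * (a x - b) + t ^ 2 * c ^ 2) :=
        Finset.sum_le_sum fun x _ => mul_le_mul_of_nonneg_left (hexp x) (hp.1 x)
    _ = (∑ x, p x) * (1 - t * b + t ^ 2 * c ^ 2) + t * b := by
        have : t * b = ∑ x, t * (p x * a x) := by rw [hb, Finset.mul_sum]
        rw [this, Finset.sum_mul, ← Finset.sum_add_distrib, ← this]
        exact Finset.sum_congr rfl fun x _ => by ring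
    _ = t ^ 2 * c ^ 2 + 1 := by rw [hp.2]; ring
    _ ≤ Real.exp (t ^ 2 * c ^ 2) := Real.add_one_le_exp _

/-- The exponential moment bound behind McDiarmid's inequality. The crude constant and the
restriction `t * c ≤ 1` allow a proof by `exp x ≤ 1 + x + x ^ 2` alone. -/
theorem prodExpect_exp_le {P : Fin k → Ω → ℝ} (hP : ∀ i, P i ∈ stdSimplex ℝ Ω)
    {G : (Fin k → Ω) → ℝ} {c t : ℝ} (hG : ∀ w i x, |G w - G (Function.update w i x)| ≤ c)
    (ht : 0 ≤ t) (htc : t * c ≤ 1) :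
    prodExpect P (fun w => Real.exp (t * G w)) ≤
      Real.exp (t * prodExpect P G + k * (t ^ 2 * c ^ 2)) := by
  induction k with
  | zero => simp [prodExpect]
  | succ k ih =>
    rw [prodExpect_succ P (fun w => Real.exp (t * G w)), prodExpect_succ P G]
    set a : (Fin k → Ω) → ℝ :=
      fun w => ∑ x, P (Fin.last k) x * G (Fin.snoc w x : Fin (k + 1) → Ω)
    have ha : ∀ w i x, |a w - a (Function.update w i x)| ≤ c := by
      intro w i x
      rw [← Finset.sum_sub_distrib]
      refine (Finset.abs_sum_le_sum_abs _ _).trans ?_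
      calc ∑ y, |P (Fin.last k) y * G (Fin.snoc w y : Fin (k + 1) → Ω) - P (Fin.last k) y *
              G (Fin.snoc (Function.update w i x) y : Fin (k + 1) → Ω)|
          ≤ ∑ y, P (Fin.last k) y * c := Finset.sum_le_sum fun y _ => by
            rw [← mul_sub, abs_mul, abs_of_nonneg ((hP _).1 y), Fin.snoc_update]
            exact mul_le_mul_of_nonneg_left (hG _ _ _) ((hP _).1 y)
        _ = c := by rw [← Finset.sum_mul, (hP _).2, one_mul]
    have hin : ∀ w, ∑ x, P (Fin.last k) x * Real.exp (t * G (Fin.snoc w x : Fin (k + 1) → Ω)) ≤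
        Real.exp (t ^ 2 * c ^ 2) * Real.exp (t * a w) := fun w => by
      rw [← Real.exp_add, add_comm (t ^ 2 * c ^ 2)]
      refine sum_mul_exp_le (hP _) (fun x y => ?_) ht htc
      have := hG (Fin.snoc w x : Fin (k + 1) → Ω) (Fin.last k) y
      rwa [Fin.update_snoc_last] at this
    refine (prodExpect_mono (fun i => (hP _).1) hin).trans ?_
    rw [prodExpect_mul_left]
    refine (mul_le_mul_of_nonneg_left (ih (fun i => hP _) ha) (Real.exp_pos _).le).trans_eq ?_
    rw [← Real.exp_add]
    congr 1
    push_cast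
    ring

/-- The expected maximum of finitely many functions with bounded differences exceeds a common bound
`B` of their expectations by little, their number entering only through its logarithm. -/
theorem prodExpect_le_of_forall_exists_le {ι : Type*} [Fintype ι] {P : Fin k → Ω → ℝ}
    (hP : ∀ i, P i ∈ stdSimplex ℝ Ω) {G : ι → (Fin k → Ω) → ℝ} {c t B : ℝ}
    (hG : ∀ T w i x, |G T w - G T (Function.update w i x)| ≤ c) (ht : 0 < t) (htc : t * c ≤ 1)
    (hB : ∀ T, prodExpect P (G T) ≤ B) {M : (Fin k → Ω) → ℝ} (hM : ∀ w, ∃ T, M w ≤ G T w) :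
    prodExpect P M ≤ B + Real.log (Fintype.card ι) / t + t * (k * c ^ 2) := by
  rcases isEmpty_or_nonempty (Fin k → Ω) with hΩ | ⟨⟨w₀⟩⟩
  · obtain ⟨w, -⟩ := exists_prodExpect_le hP M
    exact hΩ.elim w
  have hι : (0 : ℝ) < Fintype.card ι := by
    have : Nonempty ι := ⟨(hM w₀).choose⟩
    exact_mod_cast Fintype.card_pos
  set B' := B + Real.log (Fintype.card ι) / t + t * (k * c ^ 2) with hB'
  have h1 : ∀ w, t * M w + (1 - t * B') ≤ Real.exp (-(t * B')) * ∑ T, Real.exp (t * G T w) := by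
    intro w
    obtain ⟨T, hT⟩ := hM w
    calc t * M w + (1 - t * B') ≤ t * G T w + -(t * B') + 1 := by nlinarith
      _ ≤ Real.exp (t * G T w + -(t * B')) := Real.add_one_le_exp _
      _ = Real.exp (-(t * B')) * Real.exp (t * G T w) := by rw [Real.exp_add, mul_comm]
      _ ≤ _ := mul_le_mul_of_nonneg_left
          (Finset.single_le_sum (f := fun T => Real.exp (t * G T w))
            (fun T _ => (Real.exp_pos _).le) (Finset.mem_univ T)) (Real.exp_pos _).le
  have h2 := prodExpect_mono (fun i => (hP i).1) h1
  rw [prodExpect_add, prodExpect_mul_left, prodExpect_mul_left, prodExpect_sum,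
    prodExpect_const fun i => (hP i).2] at h2
  have h3 : ∑ T, prodExpect P (fun w => Real.exp (t * G T w)) ≤
      Fintype.card ι * Real.exp (t * B + k * (t ^ 2 * c ^ 2)) := by
    rw [← nsmul_eq_mul, ← Finset.card_univ]
    refine Finset.sum_le_card_nsmul _ _ _ fun T _ =>
      (prodExpect_exp_le hP (hG T) ht.le htc).trans (Real.exp_le_exp.2 ?_)
    have := mul_le_mul_of_nonneg_left (hB T) ht.le
    linarith
  have h4 : Real.exp (-(t * B')) *
      (Fintype.card ι * Real.exp (t * B + k * (t ^ 2 * c ^ 2))) = 1 := by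
    nth_rw 1 [← Real.exp_log hι]
    rw [← Real.exp_add, ← Real.exp_add, Real.exp_eq_one_iff, hB']
    field_simp
    ring
  have h5 := h2.trans ((mul_le_mul_of_nonneg_left h3 (Real.exp_pos _).le).trans_eq h4)
  have h6 : t * prodExpect P M ≤ t * B' := by linarith
  exact le_of_mul_le_mul_left h6 ht

end Concentration

/-! ### Samples with open positions -/

section Fill

variable {X ι : Type*} [Fintype ι] {n m k : ℕ}

open Classical in
/-- The law of a sample point that is either fixed (`some v`) or open (`none`), when an open point
is drawn from `U`. -/
noncomputable def fillLaw (U : X → ℝ) (o : Option X) : X → ℝ :=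
  o.elim U fun v => Pi.single v 1

/-- The law of a uniformly random point of the sample `o`, whose open points are drawn
from `U`. -/
noncomputable def mixLaw (o : Fin m → Option X) (U : X → ℝ) : X → ℝ :=
  fun x => ∑ i, (m : ℝ)⁻¹ * fillLaw U (o i) x

open Classical in
/-- The empirical law of a sample. -/
noncomputable def empLaw (y : Fin m → X) : X → ℝ :=
  fun x => ∑ i, (m : ℝ)⁻¹ * (Pi.single (y i) 1 : X → ℝ) x

theorem mixLaw_mixture {α : ι → ℝ} (hα : ∑ l, α l = 1) (U : ι → X → ℝ) (o : Fin m → Option X) :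
    mixLaw o (fun x => ∑ l, α l * U l x) = fun x => ∑ l, α l * mixLaw o (U l) x := by
  have hfill : ∀ (o : Option X) x,
      fillLaw (fun x => ∑ l, α l * U l x) o x = ∑ l, α l * fillLaw (U l) o x := by
    rintro (_ | v) x
    · rfl
    · simp [fillLaw, ← Finset.sum_mul, hα]
  funext x
  simp only [mixLaw, hfill, Finset.mul_sum]
  rw [Finset.sum_comm]
  exact Finset.sum_congr rfl fun _ _ => Finset.sum_congr rfl fun _ _ => by ring

variable [Fintype X]

theorem mixture_mem_stdSimplex {α : ι → ℝ} (hα : α ∈ stdSimplex ℝ ι) {P : ι → X → ℝ}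
    (hP : ∀ i, P i ∈ stdSimplex ℝ X) : (fun x => ∑ i, α i * P i x) ∈ stdSimplex ℝ X := by
  refine ⟨fun x => Finset.sum_nonneg fun i _ => mul_nonneg (hα.1 i) ((hP i).1 x), ?_⟩
  rw [Finset.sum_comm]
  simp only [← Finset.mul_sum, (hP _).2, mul_one, hα.2]

theorem inv_card_mem_stdSimplex (hm : 0 < m) :
    (fun _ : Fin m => (m : ℝ)⁻¹) ∈ stdSimplex ℝ (Fin m) := by
  have : (m : ℝ) ≠ 0 := by exact_mod_cast hm.ne'
  exact ⟨fun _ => by positivity, by simp [this]⟩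

theorem sum_abs_sub_le_two {p q : X → ℝ} (hp : p ∈ stdSimplex ℝ X) (hq : q ∈ stdSimplex ℝ X) :
    ∑ x, |p x - q x| ≤ 2 := by
  have : ∀ x, |p x - q x| ≤ p x + q x := fun x => by
    have := hp.1 x
    have := hq.1 x
    rw [abs_le]
    constructor <;> linarith
  refine (Finset.sum_le_sum fun x _ => this x).trans_eq ?_
  rw [Finset.sum_add_distrib, hp.2, hq.2]
  norm_num

theorem fillLaw_mem_stdSimplex {U : X → ℝ} (hU : U ∈ stdSimplex ℝ X) (o : Option X) :
    fillLaw U o ∈ stdSimplex ℝ X := by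
  cases o with
  | none => exact hU
  | some v =>
    classical
    exact single_mem_stdSimplex ℝ v

theorem mixLaw_mem_stdSimplex (hm : 0 < m) {U : X → ℝ} (hU : U ∈ stdSimplex ℝ X)
    (o : Fin m → Option X) : mixLaw o U ∈ stdSimplex ℝ X :=
  mixture_mem_stdSimplex (inv_card_mem_stdSimplex hm) fun i => fillLaw_mem_stdSimplex hU (o i)

theorem empLaw_mem_stdSimplex (hm : 0 < m) (y : Fin m → X) : empLaw y ∈ stdSimplex ℝ X := by
  classical
  exact mixture_mem_stdSimplex (inv_card_mem_stdSimplex hm) fun _ => single_mem_stdSimplex ℝ _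

theorem prodExpect_empLaw (y : Fin m → X) (f : (Fin n → X) → ℝ) :
    prodExpect (fun _ => empLaw y) f = prodExpect (fun _ _ => (m : ℝ)⁻¹) (fun e => f (y ∘ e)) := by
  classical
  unfold empLaw
  rw [prodExpect_mixture (fun (_ : Fin n) (_ : Fin m) => (m : ℝ)⁻¹)
    (fun _ i => Pi.single (y i) 1)]
  congr 1
  funext e
  convert prodExpect_pi_single (y ∘ e) f using 3
  rfl

/-- Any way to fill the open points has the same empirical law as drawing them from a suitable
distribution. -/
theorem exists_empLaw_eq_mixLaw [Nonempty X] (o : Fin m → Option X) (y : Fin m → X) :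
    ∃ V ∈ stdSimplex ℝ X, empLaw (fun i => (o i).getD (y i)) = mixLaw o V := by
  classical
  by_cases h : ∃ i, o i = none
  · let H := {i // o i = none}
    have : Nonempty H := ⟨⟨h.choose, h.choose_spec⟩⟩
    have hH : (Fintype.card H : ℝ) ≠ 0 := by exact_mod_cast Fintype.card_ne_zero
    let V : X → ℝ := fun x =>
      ∑ q : H, (Fintype.card H : ℝ)⁻¹ * (Pi.single (y q) 1 : X → ℝ) x
    refine ⟨V, mixture_mem_stdSimplex ⟨fun _ => by positivity, by simp [hH]⟩
      fun q => single_mem_stdSimplex ℝ _, funext fun x => ?_⟩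
    have hsum : ∀ g : Fin m → ℝ, ∑ i, g i = ∑ q : H, g q + ∑ i with o i ≠ none, g i := fun g => by
      rw [← Finset.sum_filter_add_sum_filter_not _ (fun i => o i = none)]
      congr 1
      exact Finset.sum_subtype _ (by simp) g
    simp only [empLaw, mixLaw, ← Finset.mul_sum]
    congr 1
    rw [hsum, hsum fun i => fillLaw V (o i) x]
    congr 1
    · have h1 : ∀ q : H, fillLaw V (o q) x = V x := fun q => by rw [q.2]; rfl
      have h2 : ∀ q : H, (Pi.single ((o q).getD (y q)) 1 : X → ℝ) x =
          (Pi.single (y q) 1 : X → ℝ) x := fun q => by rw [q.2]; rfl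
      rw [Finset.sum_congr rfl fun q _ => h1 q, Finset.sum_const, Finset.card_univ, nsmul_eq_mul]
      simp only [V]
      rw [← Finset.mul_sum, mul_inv_cancel_left₀ hH]
      refine Finset.sum_congr rfl fun q _ => ?_
      convert h2 q
    · refine Finset.sum_congr rfl fun i hi => ?_
      obtain ⟨v, hv⟩ := Option.ne_none_iff_exists'.1 (Finset.mem_filter.1 hi).2
      simp only [hv, fillLaw, Option.elim_some]
      congr!
  · push Not at h
    obtain ⟨v⟩ := ‹Nonempty X›
    refine ⟨Pi.single v 1, single_mem_stdSimplex ℝ v, funext fun x => ?_⟩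
    refine Finset.sum_congr rfl fun i _ => ?_
    obtain ⟨v, hv⟩ := Option.ne_none_iff_exists'.1 (h i)
    simp only [hv, fillLaw, Option.elim_some]
    congr!

theorem abs_prodExpect_mixLaw_sub_le (hm : 0 < m) {U : X → ℝ} (hU : U ∈ stdSimplex ℝ X)
    {f : (Fin n → X) → ℝ} (hf : ∀ x, f x ∈ Set.Icc (0 : ℝ) 1) {o o' : Fin m → Option X}
    {i : Fin m} (ho : ∀ j ≠ i, o j = o' j) :
    |prodExpect (fun _ => mixLaw o U) f - prodExpect (fun _ => mixLaw o' U) f| ≤ 2 * n / m := by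
  refine (abs_prodExpect_sub_le (mixLaw_mem_stdSimplex hm hU o) (mixLaw_mem_stdSimplex hm hU o')
    hf).trans ?_
  have h1 : ∀ x, mixLaw o U x - mixLaw o' U x =
      (m : ℝ)⁻¹ * (fillLaw U (o i) x - fillLaw U (o' i) x) := fun x => by
    simp only [mixLaw]
    rw [← Finset.sum_sub_distrib, Finset.sum_eq_single i]
    · ring
    · intro j _ hj
      rw [ho j hj, sub_self]
    · simp
  have h2 := sum_abs_sub_le_two (fillLaw_mem_stdSimplex hU (o i)) (fillLaw_mem_stdSimplex hU (o' i))
  have hm' : (0 : ℝ) ≤ (m : ℝ)⁻¹ := by positivity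
  simp only [h1, abs_mul, ← Finset.mul_sum, abs_of_nonneg hm']
  calc (n : ℝ) * ((m : ℝ)⁻¹ * ∑ x, |fillLaw U (o i) x - fillLaw U (o' i) x|)
      ≤ n * ((m : ℝ)⁻¹ * 2) := by gcongr
    _ = 2 * n / m := by ring

/-- Subsampling a sample with independent points amounts to `n` independent draws from the average
of their laws, up to the probability of a collision. -/
theorem abs_prodExpect_subsample_sub_le (hnm : n ≤ m) (hm : 0 < m) {P : Fin m → X → ℝ}
    (hP : ∀ i, P i ∈ stdSimplex ℝ X) {f : (Fin n → X) → ℝ}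
    (hf : ∀ x, f x ∈ Set.Icc (0 : ℝ) 1) :
    |embAvg n m (fun e => prodExpect (fun j => P (e j)) f) -
      prodExpect (fun _ x => ∑ i, (m : ℝ)⁻¹ * P i x) f| ≤ (n : ℝ) ^ 2 / m := by
  rw [prodExpect_mixture (fun (_ : Fin n) (_ : Fin m) => (m : ℝ)⁻¹) (fun _ => P)]
  exact abs_embAvg_sub_prodExpect_le hnm hm fun e => prodExpect_mem_Icc (fun j => hP (e j)) hf

theorem prodExpect_mixLaw_le {Ω : Type*} [Fintype Ω] (hnm : n ≤ m) (hm : 0 < m)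
    {ν : Fin m → Ω → ℝ} (hν : ∀ i, ν i ∈ stdSimplex ℝ Ω) (φ : Fin m → Ω → Option X)
    {U : X → ℝ} (hU : U ∈ stdSimplex ℝ X)
    {f : (Fin n → X) → ℝ} (hf : ∀ x, f x ∈ Set.Icc (0 : ℝ) 1) :
    prodExpect ν (fun w => prodExpect (fun _ => mixLaw (fun i => φ i (w i)) U) f) ≤
      prodExpect (fun _ x => ∑ i, (m : ℝ)⁻¹ * ∑ ω, ν i ω * fillLaw U (φ i ω) x) f +
        2 * (n : ℝ) ^ 2 / m := by
  have h1 : ∀ w : Fin m → Ω, prodExpect (fun _ => mixLaw (fun i => φ i (w i)) U) f ≤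
      embAvg n m (fun e => prodExpect (fun j => fillLaw U (φ (e j) (w (e j)))) f) +
        (n : ℝ) ^ 2 / m := fun w => by
    have := (abs_le.1 (abs_prodExpect_subsample_sub_le hnm hm
      (fun i => fillLaw_mem_stdSimplex hU (φ i (w i))) hf)).1
    unfold mixLaw
    linarith
  refine (prodExpect_mono (fun i => (hν i).1) h1).trans ?_
  rw [prodExpect_add, prodExpect_const fun i => (hν i).2, prodExpect_embAvg,
    embAvg_congr (h' := fun e =>
      prodExpect (fun j x => ∑ ω, ν (e j) ω * fillLaw U (φ (e j) ω) x) f)]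
  · have := (abs_le.1 (abs_prodExpect_subsample_sub_le hnm hm
      (P := fun i x => ∑ ω, ν i ω * fillLaw U (φ i ω) x)
      (fun i => mixture_mem_stdSimplex (hν i) fun ω => fillLaw_mem_stdSimplex hU _) hf)).2
    have h2 : 2 * (n : ℝ) ^ 2 / m = (n : ℝ) ^ 2 / m + (n : ℝ) ^ 2 / m := by ring
    linarith
  · intro e he
    rw [prodExpect_mixture (fun j => ν (e j)) (fun j ω => fillLaw U (φ (e j) ω))]
    exact prodExpect_comp_injective (fun i => (hν i).2) he
      (fun w' => prodExpect (fun j => fillLaw U (φ (e j) (w' j))) f)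

/-- An adversary who fills the open points of a random sample after having seen all of it gains
little over one who commits to a distribution `U` for these points in advance. -/
theorem prodExpect_fill_le [Nonempty X] {Ω : Type*} [Fintype Ω] (hnm : n ≤ m) (hm : 0 < m)
    (hnk : n ≤ k) (hk : 0 < k) {ν : Fin m → Ω → ℝ} (hν : ∀ i, ν i ∈ stdSimplex ℝ Ω)
    (φ : Fin m → Ω → Option X) {f : (Fin n → X) → ℝ} (hf : ∀ x, f x ∈ Set.Icc (0 : ℝ) 1)
    {t B : ℝ} (ht : 0 < t) (htm : t * (2 * n / m) ≤ 1)
    (hB : ∀ U ∈ stdSimplex ℝ X,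
      prodExpect (fun _ x => ∑ i, (m : ℝ)⁻¹ * ∑ ω, ν i ω * fillLaw U (φ i ω) x) f ≤ B)
    {M : (Fin m → Ω) → ℝ}
    (hM : ∀ w, ∃ y : Fin m → X,
      M w ≤ embAvg n m (fun e => f ((fun i => (φ i (w i)).getD (y i)) ∘ e))) :
    prodExpect ν M ≤ B + 3 * (n : ℝ) ^ 2 / m + (n : ℝ) ^ 2 / k +
      k * Real.log (Fintype.card X) / t + t * (m * (2 * n / m) ^ 2) := by
  classical
  have key := prodExpect_le_of_forall_exists_le hν
    (G := fun (T : Fin k → X) w => prodExpect (fun _ => mixLaw (fun i => φ i (w i)) (empLaw T)) f)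
    (c := 2 * n / m) (t := t) (B := B + 2 * (n : ℝ) ^ 2 / m)
    (M := fun w => M w - ((n : ℝ) ^ 2 / m + (n : ℝ) ^ 2 / k)) ?_ ht htm ?_ ?_
  · rw [prodExpect_sub, prodExpect_const fun i => (hν i).2, Fintype.card_fun, Fintype.card_fin,
      Nat.cast_pow, Real.log_pow] at key
    have h2 : 3 * (n : ℝ) ^ 2 / m = 2 * (n : ℝ) ^ 2 / m + (n : ℝ) ^ 2 / m := by ring
    linarith
  · intro T w i x
    refine abs_prodExpect_mixLaw_sub_le hm (empLaw_mem_stdSimplex hk T) hf (i := i) fun j hj => ?_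
    rw [Function.update_of_ne hj]
  · intro T
    have hT := empLaw_mem_stdSimplex hk T
    exact (prodExpect_mixLaw_le hnm hm hν φ hT hf).trans (by linarith [hB _ hT])
  · intro w
    obtain ⟨y, hy⟩ := hM w
    set o : Fin m → Option X := fun i => φ i (w i)
    obtain ⟨V, hV, hVo⟩ := exists_empLaw_eq_mixLaw o y
    have h1 := (abs_le.1 (abs_embAvg_sub_prodExpect_le hnm hm
      (h := fun e => f ((fun i => (o i).getD (y i)) ∘ e)) fun e => hf _)).2
    -- `h u` is the value when the `j`-th draw shows `u j` in case it hits an open position.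
    set h : (Fin n → X) → ℝ := fun u => prodExpect (fun j => mixLaw o (Pi.single (u j) 1)) f
    have hsingle : ∀ x, mixLaw o (Pi.single x 1) ∈ stdSimplex ℝ X :=
      fun x => mixLaw_mem_stdSimplex hm (single_mem_stdSimplex ℝ x) o
    obtain ⟨T, hT⟩ := exists_prodExpect_le_sample hnk hk hV (h := h)
      fun u => prodExpect_mem_Icc (fun j => hsingle (u j)) hf
    refine ⟨T, ?_⟩
    have h2 : prodExpect (fun _ => V) h = prodExpect (fun _ => mixLaw o V) f := by
      have : V = fun x => ∑ v, V v * (Pi.single v 1 : X → ℝ) x := by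
        funext x; simp [Pi.single_apply]
      conv_rhs => rw [this]
      rw [mixLaw_mixture hV.2 (fun v => Pi.single v 1),
        prodExpect_mixture (fun _ => V) (fun _ v => mixLaw o (Pi.single v 1))]
    have h3 : prodExpect (fun _ _ => (k : ℝ)⁻¹) (fun u => h (T ∘ u)) =
        prodExpect (fun _ => mixLaw o (empLaw T)) f := by
      unfold empLaw
      rw [mixLaw_mixture (inv_card_mem_stdSimplex hk).2,
        prodExpect_mixture (fun _ _ => (k : ℝ)⁻¹) (fun _ l => mixLaw o (Pi.single (T l) 1))]
      rfl
    rw [h2, h3, ← hVo, prodExpect_empLaw] at hT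
    linarith

end Fill

/-! ### Expectations under probability mass functions -/

section PmfExpect

variable {α β : Type*} [Fintype α] [Fintype β]

/-- The expectation of `g` under a probability mass function on a finite type. -/
noncomputable def pmfExpect (μ : PMF α) (g : α → ℝ) : ℝ := ∑ a, (μ a).toReal * g a

theorem toReal_mem_stdSimplex (μ : PMF α) : (fun a => (μ a).toReal) ∈ stdSimplex ℝ α := by
  refine ⟨fun a => ENNReal.toReal_nonneg, ?_⟩
  rw [← ENNReal.toReal_sum fun a _ => μ.apply_ne_top a, ← tsum_fintype (L := .unconditional _),
    μ.tsum_coe, ENNReal.toReal_one]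

theorem exists_pmf_toReal_eq {U : α → ℝ} (hU : U ∈ stdSimplex ℝ α) :
    ∃ E : PMF α, ∀ a, (E a).toReal = U a := by
  refine ⟨PMF.ofFintype (fun a => ENNReal.ofReal (U a)) ?_, fun a => ?_⟩
  · rw [← ENNReal.ofReal_sum_of_nonneg fun a _ => hU.1 a, hU.2, ENNReal.ofReal_one]
  · rw [PMF.ofFintype_apply, ENNReal.toReal_ofReal (hU.1 a)]

theorem pmfExpect_mono (μ : PMF α) {g h : α → ℝ} (hgh : ∀ a, g a ≤ h a) :
    pmfExpect μ g ≤ pmfExpect μ h :=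
  Finset.sum_le_sum fun a _ => mul_le_mul_of_nonneg_left (hgh a) ENNReal.toReal_nonneg

theorem pmfExpect_const (μ : PMF α) (c : ℝ) : pmfExpect μ (fun _ => c) = c := by
  rw [pmfExpect, ← Finset.sum_mul, (toReal_mem_stdSimplex μ).2, one_mul]

theorem toReal_bind_apply {γ : Type*} (μ : PMF α) (κ : α → PMF γ) (b : γ) :
    (μ.bind κ b).toReal = pmfExpect μ fun a => (κ a b).toReal := by
  rw [PMF.bind_apply, tsum_fintype, ENNReal.toReal_sum fun a _ =>
    ENNReal.mul_ne_top (μ.apply_ne_top a) ((κ a).apply_ne_top b)]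
  simp only [ENNReal.toReal_mul, pmfExpect]

theorem pmfExpect_bind (μ : PMF α) (κ : α → PMF β) (g : β → ℝ) :
    pmfExpect (μ.bind κ) g = pmfExpect μ fun a => pmfExpect (κ a) g := by
  simp only [pmfExpect, toReal_bind_apply, Finset.sum_mul, Finset.mul_sum]
  rw [Finset.sum_comm]
  exact Finset.sum_congr rfl fun _ _ => Finset.sum_congr rfl fun _ _ => by ring

theorem pmfExpect_map (μ : PMF α) (h : α → β) (g : β → ℝ) :
    pmfExpect (μ.map h) g = pmfExpect μ fun a => g (h a) := by
  classical
  rw [PMF.map, pmfExpect_bind]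
  congr 1
  funext a
  simp [pmfExpect, PMF.pure_apply, apply_ite ENNReal.toReal]

end PmfExpect

section Values

variable {X : Type*} {n m k : ℕ}

theorem toReal_mix_apply (η : unitInterval) (D E : PMF X) (x : X) :
    (mix η D E x).toReal = (1 - η) * (D x).toReal + η * (E x).toReal := by
  rw [mix_apply, ENNReal.toReal_add
    (ENNReal.mul_ne_top ENNReal.ofReal_ne_top (D.apply_ne_top x))
    (ENNReal.mul_ne_top ENNReal.ofReal_ne_top (E.apply_ne_top x)), ENNReal.toReal_mul,
    ENNReal.toReal_mul, ENNReal.toReal_ofReal (sub_nonneg.2 η.2.2), ENNReal.toReal_ofReal η.2.1]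

theorem successProb_le_one (μ : PMF (Fin k → X)) (A : (Fin k → X) → PMF Bool) :
    successProb μ A ≤ 1 :=
  ENNReal.toReal_le_of_le_ofReal zero_le_one
    (by simpa only [ENNReal.ofReal_one] using PMF.coe_le_one _ _)

/-- The map `f` with `true` and `false` read as `1` and `0`. -/
def boolValue (f : (Fin n → X) → Bool) : (Fin n → X) → ℝ := fun x => if f x then 1 else 0

/-- The expected value of `f` on a subsample of `S`. -/
noncomputable def subValue (f : (Fin n → X) → Bool) (S : Fin m → X) : ℝ :=
  embAvg n m fun e => boolValue f (S ∘ e)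

theorem boolValue_mem_Icc (f : (Fin n → X) → Bool) (x : Fin n → X) :
    boolValue f x ∈ Set.Icc (0 : ℝ) 1 := by
  unfold boolValue
  split_ifs <;> simp

theorem toReal_deterministic (f : (Fin n → X) → Bool) (S : Fin n → X) :
    (deterministic f S true).toReal = boolValue f S := by
  cases h : f S <;> simp [deterministic, boolValue, h]

theorem toReal_compSubsample (f : (Fin n → X) → Bool) (h : n ≤ m) (S : Fin m → X) :
    (compSubsample f h S true).toReal = subValue f S := by
  have : Nonempty (Fin n ↪ Fin m) := ⟨Fin.castLEEmb h⟩
  have h1 : compSubsample f h S true = ((PMF.uniformOfFintype (Fin n ↪ Fin m)).bind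
      fun e => PMF.pure (f (S ∘ e))) true := by
    unfold compSubsample subsample
    rw [PMF.map_comp]
    change PMF.map (f ∘ fun e => S ∘ e) ((PMF.uniformOfFintype (Fin n ↪ Fin m)).bind
      fun a => PMF.pure (a : Fin n → Fin m)) true = _
    simp only [PMF.map_bind, PMF.pure_map, Function.comp_def]
  rw [h1, toReal_bind_apply, pmfExpect, subValue, embAvg, Finset.sum_div]
  refine Finset.sum_congr rfl fun e _ => ?_
  rw [PMF.uniformOfFintype_apply]
  cases h : f (S ∘ e) <;> simp [boolValue, h]

theorem subValue_comp_perm (f : (Fin n → X) → Bool) (S : Fin m → X) (σ : Equiv.Perm (Fin m)) :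
    subValue f (S ∘ σ) = subValue f S := by
  unfold subValue embAvg
  congr 1
  exact (Equiv.embeddingCongr (Equiv.refl (Fin n)) σ).sum_comp
    fun e : Fin n ↪ Fin m => boolValue f (S ∘ e)

/-- The order in which clean and added points are combined is irrelevant. -/
theorem subValue_combine {a b : ℕ} (f : (Fin n → X) → Bool) (S : Fin a → X) (T : Fin b → X)
    (σ σ' : Fin m ≃ Fin a ⊕ Fin b) :
    subValue f (combine S T σ) = subValue f (combine S T σ') := by
  rw [← subValue_comp_perm f (combine S T σ') (σ.trans σ'.symm)]
  congr 1
  funext i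
  simp [combine]

variable [Fintype X]

theorem sum_mul_fillLaw_some (U p : X → ℝ) (x : X) : ∑ v, p v * fillLaw U (some v) x = p x := by
  rw [Finset.sum_eq_single x]
  · simp [fillLaw]
  · intro v _ hv
    simp [fillLaw, hv.symm]
  · simp

theorem pmfExpect_iid (D : PMF X) (g : (Fin k → X) → ℝ) :
    pmfExpect (iid D k) g = prodExpect (fun _ x => (D x).toReal) g := by
  simp [pmfExpect, prodExpect, iid, ENNReal.toReal_prod]

theorem successProb_eq (μ : PMF (Fin k → X)) (A : (Fin k → X) → PMF Bool) :
    successProb μ A = pmfExpect μ fun S => (A S true).toReal :=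
  toReal_bind_apply μ A true

theorem prodExpect_subValue {P : Fin m → X → ℝ} (hP : ∀ i, ∑ x, P i x = 1)
    (f : (Fin n → X) → Bool) :
    prodExpect P (subValue f) =
      embAvg n m fun e => prodExpect (fun j => P (e j)) (boolValue f) := by
  have := prodExpect_embAvg P (fun S e => boolValue f (S ∘ e)) (n := n) (m := m)
  refine this.trans (embAvg_congr fun e he => ?_)
  exact prodExpect_comp_injective hP he (boolValue f)

theorem prodExpect_combine {a b : ℕ} (p q : X → ℝ) (σ : Fin m ≃ Fin a ⊕ Fin b)
    (g : (Fin m → X) → ℝ) :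
    prodExpect (fun i x => Sum.elim (fun _ => p x) (fun _ => q x) (σ i)) g =
      prodExpect (fun _ => q) fun T => prodExpect (fun _ => p) fun S => g (combine S T σ) := by
  simp only [prodExpect, Finset.mul_sum]
  rw [← Fintype.sum_prod_type_right',
    ← ((Equiv.sumArrowEquivProdArrow (Fin a) (Fin b) X).symm.trans
      (σ.arrowCongr (Equiv.refl X)).symm).sum_comp]
  refine Finset.sum_congr rfl fun z _ => ?_
  have h1 : ((Equiv.sumArrowEquivProdArrow (Fin a) (Fin b) X).symm.trans
      (σ.arrowCongr (Equiv.refl X)).symm) z = combine z.1 z.2 σ := by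
    funext i
    rfl
  have h2 : ∏ i, Sum.elim (fun _ => p (combine z.1 z.2 σ i)) (fun _ => q (combine z.1 z.2 σ i))
      (σ i) = (∏ i, p (z.1 i)) * ∏ j, q (z.2 j) := by
    rw [← σ.symm.prod_comp, Fintype.prod_sum_type]
    simp [combine]
  rw [h1, h2]
  ring

/-! ### The oblivious adversary -/

theorem prodExpect_mix_le_obliviousAddMax (η : unitInterval) (D : PMF X) (f : (Fin n → X) → Bool)
    {U : X → ℝ} (hU : U ∈ stdSimplex ℝ X) :
    prodExpect (fun _ x => (1 - η) * (D x).toReal + η * U x) (boolValue f) ≤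
      obliviousAddMax η (deterministic f) D := by
  obtain ⟨E, hE⟩ := exists_pmf_toReal_eq hU
  have h1 : successProb (iid (mix η D E) n) (deterministic f) =
      prodExpect (fun _ x => (1 - η) * (D x).toReal + η * U x) (boolValue f) := by
    rw [successProb_eq, pmfExpect_iid]
    simp only [toReal_deterministic, toReal_mix_apply, hE]
  rw [← h1]
  exact le_ciSup (f := fun D' : addDist η D => successProb (iid (D' : PMF X) n) (deterministic f))
    ⟨1, by rintro _ ⟨D', rfl⟩; exact successProb_le_one _ _⟩ ⟨mix η D E, E, rfl⟩

theorem obliviousAddMax_le (η : unitInterval) (D : PMF X) (f : (Fin n → X) → Bool) {c : ℝ}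
    (h : ∀ E : PMF X, prodExpect (fun _ x => (mix η D E x).toReal) (boolValue f) ≤ c) :
    obliviousAddMax η (deterministic f) D ≤ c := by
  have : Nonempty (addDist η D) := ⟨⟨mix η D D, D, rfl⟩⟩
  refine ciSup_le ?_
  rintro ⟨_, E, rfl⟩
  rw [successProb_eq, pmfExpect_iid]
  simpa only [toReal_deterministic] using h E

/-! ### The malicious adversary -/

theorem pmfExpect_malSample_succ (η : unitInterval) (D : PMF X) (s : MalStrategy X)
    (g : (Fin (k + 1) → X) → ℝ) :
    pmfExpect (malSample η D s (k + 1)) g = pmfExpect (malSample η D s k) fun S =>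
      ∑ x, ((1 - η) * (D x).toReal + η * (s k S x).toReal) *
        g (Fin.snoc S x : Fin (k + 1) → X) := by
  have h : malSample η D s (k + 1) = (malSample η D s k).bind fun S =>
      (mix η D (s k S)).map fun x => (Fin.snoc S x : Fin (k + 1) → X) := by
    simp only [malSample, mix, PMF.map_bind]
  rw [h, pmfExpect_bind]
  simp only [pmfExpect_map]
  simp only [pmfExpect, toReal_mix_apply]

/-- Against a constant strategy, the sample is i.i.d. -/
theorem pmfExpect_malSample_const (η : unitInterval) (D E : PMF X) (g : (Fin k → X) → ℝ) :
    pmfExpect (malSample η D (fun _ _ => E) k) g =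
      prodExpect (fun _ x => (mix η D E x).toReal) g := by
  induction k with
  | zero =>
    rw [malSample, pmfExpect, prodExpect, Fintype.sum_unique, Fintype.sum_unique]
    simp [Subsingleton.elim (default : Fin 0 → X) Fin.elim0]
  | succ k ih => rw [pmfExpect_malSample_succ, ih, prodExpect_succ]; simp only [toReal_mix_apply]

theorem obliviousAddMax_le_malMax (η : unitInterval) (D : PMF X) (f : (Fin n → X) → Bool)
    (h : n ≤ m) : obliviousAddMax η (deterministic f) D ≤ malMax η (compSubsample f h) D := by
  refine obliviousAddMax_le η D f fun E => ?_
  have h1 : successProb (malSample η D (fun _ _ => E) m) (compSubsample f h) =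
      prodExpect (fun _ x => (mix η D E x).toReal) (boolValue f) := by
    rw [successProb_eq, pmfExpect_malSample_const]
    simp only [toReal_compSubsample]
    exact (prodExpect_subValue (fun _ => (toReal_mem_stdSimplex (mix η D E)).2) f).trans
      (embAvg_const h _)
  rw [← h1]
  exact le_ciSup (f := fun s : MalStrategy X => successProb (malSample η D s m) (compSubsample f h))
    ⟨1, by rintro _ ⟨s, rfl⟩; exact successProb_le_one _ _⟩ _

/-- The law of a sample point under malicious noise, as a clean point or an open position. -/
noncomputable def noisyLaw (η : unitInterval) (D : PMF X) : Option X → ℝ :=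
  fun o => o.elim (η : ℝ) fun x => (1 - η) * (D x).toReal

theorem noisyLaw_mem_stdSimplex (η : unitInterval) (D : PMF X) :
    noisyLaw η D ∈ stdSimplex ℝ (Option X) := by
  refine ⟨?_, ?_⟩
  · rintro (_ | x)
    · exact η.2.1
    · exact mul_nonneg (sub_nonneg.2 η.2.2) ENNReal.toReal_nonneg
  · simp [Fintype.sum_option, noisyLaw, ← Finset.mul_sum, (toReal_mem_stdSimplex D).2]

/-- The malicious adversary does no better than one who fills the open positions knowing all coins
and all clean points. -/
theorem pmfExpect_malSample_le [Nonempty X] (η : unitInterval) (D : PMF X) (s : MalStrategy X)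
    (g : (Fin k → X) → ℝ) :
    pmfExpect (malSample η D s k) g ≤ prodExpect (fun _ => noisyLaw η D) fun w =>
      ⨆ y : Fin k → X, g fun i => (w i).getD (y i) := by
  have hbdd : ∀ {ι : Type _} [Finite ι] (h : ι → ℝ), BddAbove (Set.range h) :=
    fun h => (Set.finite_range h).bddAbove
  induction k with
  | zero =>
    rw [malSample, pmfExpect, prodExpect, Fintype.sum_unique, Fintype.sum_unique]
    have h0 : ∀ x : Fin 0 → X, g x = g Fin.elim0 := fun x => by congr; exact Subsingleton.elim _ _
    simp [Subsingleton.elim (default : Fin 0 → X) Fin.elim0, h0]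
  | succ k ih =>
    have hη : (0 : ℝ) ≤ 1 - η := sub_nonneg.2 η.2.2
    rw [pmfExpect_malSample_succ, prodExpect_succ]
    set g' : (Fin k → X) → ℝ := fun S =>
      (1 - η) * ∑ x, (D x).toReal * g (Fin.snoc S x : Fin (k + 1) → X) +
        η * ⨆ x, g (Fin.snoc S x : Fin (k + 1) → X)
    have h1 : ∀ S, ∑ x, ((1 - η) * (D x).toReal + η * (s k S x).toReal) *
        g (Fin.snoc S x : Fin (k + 1) → X) ≤ g' S := fun S => by
      have : ∑ x, (s k S x).toReal * g (Fin.snoc S x : Fin (k + 1) → X) ≤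
          ⨆ x, g (Fin.snoc S x : Fin (k + 1) → X) := by
        refine (pmfExpect_mono (s k S) fun x => ?_).trans_eq (pmfExpect_const (s k S) _)
        exact le_ciSup (hbdd fun x => g (Fin.snoc S x : Fin (k + 1) → X)) x
      simp only [add_mul, Finset.sum_add_distrib, mul_assoc, ← Finset.mul_sum]
      exact add_le_add le_rfl (mul_le_mul_of_nonneg_left this η.2.1)
    refine (pmfExpect_mono _ h1).trans ((ih g').trans ?_)
    refine prodExpect_mono (fun _ => (noisyLaw_mem_stdSimplex η D).1) fun w => ciSup_le fun y => ?_
    have h2 : ∀ o x, g (Fin.snoc (fun i => (w i).getD (y i)) (o.getD x) : Fin (k + 1) → X) ≤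
        ⨆ y' : Fin (k + 1) → X,
          g fun i => ((Fin.snoc w o : Fin (k + 1) → Option X) i).getD (y' i) := by
      intro o x
      refine le_ciSup_of_le (hbdd _) (Fin.snoc y x : Fin (k + 1) → X) (le_of_eq ?_)
      congr 1
      funext i
      refine Fin.lastCases ?_ (fun i => ?_) i <;> simp
    rw [Fintype.sum_option, add_comm]
    refine add_le_add ?_ ?_
    · rw [Finset.mul_sum]
      refine Finset.sum_le_sum fun x _ => ?_
      simp only [noisyLaw, Option.elim_some]
      rw [← mul_assoc]
      exact mul_le_mul_of_nonneg_left (h2 (some x) x)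
        (mul_nonneg hη ENNReal.toReal_nonneg)
    · exact mul_le_mul_of_nonneg_left (ciSup_le fun x => h2 none x) η.2.1

/-- The excess of `prodExpect_fill_le`, with a free number `k` of points that suffice to represent
the adversary and a free parameter `t` of the exponential moments. -/
noncomputable def fillError (X : Type*) [Fintype X] (n m k : ℕ) (t : ℝ) : ℝ :=
  3 * (n : ℝ) ^ 2 / m + (n : ℝ) ^ 2 / k + k * Real.log (Fintype.card X) / t +
    t * (m * (2 * n / m) ^ 2)

theorem malMax_le (η : unitInterval) (D : PMF X) (f : (Fin n → X) → Bool) (h : n ≤ m) (hm : 0 < m)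
    (hnk : n ≤ k) (hk : 0 < k) {t : ℝ} (ht : 0 < t) (htm : t * (2 * n / m) ≤ 1) :
    malMax η (compSubsample f h) D ≤
      obliviousAddMax η (deterministic f) D + fillError X n m k t := by
  have : Nonempty X := ⟨D.support_nonempty.some⟩
  have : Nonempty (MalStrategy X) := ⟨fun _ _ => D⟩
  refine ciSup_le fun s => ?_
  rw [successProb_eq]
  simp only [toReal_compSubsample]
  refine (pmfExpect_malSample_le η D s (subValue f)).trans ?_
  have := prodExpect_fill_le h hm hnk hk (fun _ => noisyLaw_mem_stdSimplex η D)
    (fun _ o => o) (boolValue_mem_Icc f) ht htm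
    (B := obliviousAddMax η (deterministic f) D)
    (M := fun w => ⨆ y : Fin m → X, subValue f fun i => (w i).getD (y i)) ?_ ?_
  · rw [fillError]; linarith
  · intro U hU
    refine (le_of_eq ?_).trans (prodExpect_mix_le_obliviousAddMax η D f hU)
    congr 1
    funext _ x
    have hm' : (m : ℝ) ≠ 0 := by exact_mod_cast hm.ne'
    simp only [Fintype.sum_option, noisyLaw, Option.elim_none, Option.elim_some,
      sum_mul_fillLaw_some U fun x => (1 - (η : ℝ)) * (D x).toReal]
    simp [fillLaw, hm', add_comm]
  · intro w
    obtain ⟨y, hy⟩ := exists_eq_ciSup_of_finite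
      (f := fun y : Fin m → X => subValue f fun i => (w i).getD (y i))
    exact ⟨y, hy.ge⟩

/-! ### The adaptive and the non-i.i.d. adversary -/

theorem numClean_add_numAdded (η : unitInterval) (m : ℕ) : numClean η m + numAdded η m = m := by
  have hη0 := η.2.1
  have hη1 := η.2.2
  have hm : (0 : ℝ) ≤ m := Nat.cast_nonneg m
  have hb : (numAdded η m : ℝ) ≤ η * m := Nat.floor_le (mul_nonneg hη0 hm)
  have hbm : numAdded η m ≤ m := by
    have : (numAdded η m : ℝ) ≤ m := hb.trans (mul_le_of_le_one_left hm hη1)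
    exact_mod_cast this
  have h1 : numClean η m ≤ m - numAdded η m := by
    refine Nat.ceil_le.2 ?_
    rw [Nat.cast_sub hbm]
    linarith
  have h2 : m - numClean η m ≤ numAdded η m := by
    refine Nat.le_floor ?_
    have : (1 - (η : ℝ)) * m ≤ numClean η m := Nat.le_ceil _
    rw [Nat.cast_sub (by omega)]
    linarith
  omega

/-- A fixed arrangement of the clean and the added points. -/
noncomputable def arrangement (η : unitInterval) (m : ℕ) :
    Fin m ≃ Fin (numClean η m) ⊕ Fin (numAdded η m) :=
  (finCongr (numClean_add_numAdded η m).symm).trans finSumFinEquiv.symm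

/-- The exact proportion of added points in place of `η` makes little difference. -/
theorem abs_prodExpect_arrangement_sub_le (η : unitInterval) (hm : 0 < m) (D : PMF X)
    {U : X → ℝ} (hU : U ∈ stdSimplex ℝ X) (f : (Fin n → X) → Bool) :
    |prodExpect (fun _ x => ∑ i, (m : ℝ)⁻¹ *
        Sum.elim (fun _ => (D x).toReal) (fun _ => U x) (arrangement η m i)) (boolValue f) -
      prodExpect (fun _ x => (1 - η) * (D x).toReal + η * U x) (boolValue f)| ≤ 2 * n / m := by
  have hm' : (0 : ℝ) < m := by exact_mod_cast hm
  have hD := toReal_mem_stdSimplex D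
  have hp : (fun x => ∑ i, (m : ℝ)⁻¹ * Sum.elim (fun _ => (D x).toReal) (fun _ => U x)
      (arrangement η m i)) ∈ stdSimplex ℝ X := by
    refine mixture_mem_stdSimplex (inv_card_mem_stdSimplex hm)
      (P := fun i x => Sum.elim (fun _ => (D x).toReal) (fun _ => U x) (arrangement η m i))
      fun i => ?_
    cases arrangement η m i
    · exact hD
    · exact hU
  have hq : (fun x => (1 - η) * (D x).toReal + η * U x) ∈ stdSimplex ℝ X := by
    refine ⟨fun x => add_nonneg (mul_nonneg (sub_nonneg.2 η.2.2) (hD.1 x))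
      (mul_nonneg η.2.1 (hU.1 x)), ?_⟩
    rw [Finset.sum_add_distrib, ← Finset.mul_sum, ← Finset.mul_sum, hD.2, hU.2]
    ring
  refine (abs_prodExpect_sub_le hp hq (boolValue_mem_Icc f)).trans ?_
  have hab : (numClean η m : ℝ) = m - numAdded η m := by
    rw [eq_sub_iff_add_eq]
    exact_mod_cast numClean_add_numAdded η m
  have hdiff : ∀ x, ∑ i, (m : ℝ)⁻¹ * Sum.elim (fun _ => (D x).toReal) (fun _ => U x)
      (arrangement η m i) - ((1 - η) * (D x).toReal + η * U x) =
        (η - numAdded η m / m) * ((D x).toReal - U x) := fun x => by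
    rw [← (arrangement η m).symm.sum_comp, Fintype.sum_sum_type]
    simp only [Equiv.apply_symm_apply, Sum.elim_inl, Sum.elim_inr, Finset.sum_const,
      Finset.card_univ, Fintype.card_fin, nsmul_eq_mul, hab]
    field_simp
    ring
  have hη : |(η : ℝ) - numAdded η m / m| ≤ (m : ℝ)⁻¹ := by
    have h1 : (numAdded η m : ℝ) ≤ η * m := Nat.floor_le (mul_nonneg η.2.1 hm'.le)
    have h2 : (η : ℝ) * m < numAdded η m + 1 := Nat.lt_floor_add_one _
    have h3 : (η : ℝ) - numAdded η m / m = (η * m - numAdded η m) * (m : ℝ)⁻¹ := by field_simp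
    rw [h3, abs_mul, abs_of_nonneg (sub_nonneg.2 h1), abs_of_pos (inv_pos.2 hm')]
    exact mul_le_of_le_one_left (inv_pos.2 hm').le (by linarith)
  have h2 := sum_abs_sub_le_two hD hU
  rw [Finset.sum_congr rfl fun x _ => congrArg abs (hdiff x)]
  simp only [abs_mul]
  rw [← Finset.mul_sum]
  calc (n : ℝ) * (|(η : ℝ) - numAdded η m / m| * ∑ x, |(D x).toReal - U x|)
      ≤ n * ((m : ℝ)⁻¹ * 2) := by gcongr
    _ = 2 * n / m := by ring

theorem adaptiveAddMax_le (η : unitInterval) (D : PMF X) (f : (Fin n → X) → Bool) (h : n ≤ m)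
    (hm : 0 < m) (hnk : n ≤ k) (hk : 0 < k) {t : ℝ} (ht : 0 < t) (htm : t * (2 * n / m) ≤ 1) :
    adaptiveAddMax η (compSubsample f h) D ≤
      obliviousAddMax η (deterministic f) D + 2 * n / m + fillError X n m k t := by
  have : Nonempty X := ⟨D.support_nonempty.some⟩
  have hD := toReal_mem_stdSimplex D
  set σ := arrangement η m
  have hu : Function.Injective fun p => σ.symm (Sum.inl p) :=
    σ.symm.injective.comp Sum.inl_injective
  -- The clean sample is part of a sample of `m` clean points, the rest of which is unused.
  have h1 : adaptiveAddMax η (compSubsample f h) D =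
      prodExpect (fun (_ : Fin m) x => (D x).toReal) fun z =>
        ⨆ S' : addSample η m (z ∘ fun p => σ.symm (Sum.inl p)), subValue f (S' : Fin m → X) := by
    rw [prodExpect_comp_injective (fun _ => hD.2) hu
      (fun S => ⨆ S' : addSample η m S, subValue f (S' : Fin m → X)), ← pmfExpect_iid]
    simp only [adaptiveAddMax, toReal_compSubsample, pmfExpect]
  rw [h1]
  have key := prodExpect_fill_le h hm hnk hk (fun _ => hD)
    (fun i z => Sum.elim (fun _ => some z) (fun _ => none) (σ i)) (boolValue_mem_Icc f) ht htm
    (B := obliviousAddMax η (deterministic f) D + 2 * n / m)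
    (M := fun z => ⨆ S' : addSample η m (z ∘ fun p => σ.symm (Sum.inl p)),
      subValue f (S' : Fin m → X)) ?_ ?_
  · rw [fillError]; linarith
  · intro U hU
    have h2 := (abs_le.1 (abs_prodExpect_arrangement_sub_le η hm D hU f)).2
    have h3 := prodExpect_mix_le_obliviousAddMax η D f hU
    refine le_trans (le_of_eq ?_) (sub_le_iff_le_add.1 (h2.trans' (sub_le_sub_left h3 _)) |>.trans
      (add_comm _ _).le)
    congr 1
    funext _ x
    refine Finset.sum_congr rfl fun i _ => ?_
    congr 1
    change _ = Sum.elim _ _ (σ i)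
    cases σ i
    · exact sum_mul_fillLaw_some U (fun x => (D x).toReal) x
    · simp [fillLaw, ← Finset.sum_mul, hD.2]
  · intro z
    have : Nonempty (addSample η m (z ∘ fun p => σ.symm (Sum.inl p))) :=
      ⟨⟨_, fun _ => Classical.arbitrary X, σ, rfl⟩⟩
    obtain ⟨⟨_, T, τ, rfl⟩, hS⟩ := exists_eq_ciSup_of_finite
      (f := fun S' : addSample η m (z ∘ fun p => σ.symm (Sum.inl p)) =>
        subValue f (S' : Fin m → X))
    refine ⟨fun i => Sum.elim (fun _ => z i) T (σ i), hS.symm.le.trans_eq ?_⟩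
    refine (subValue_combine f _ _ τ σ).trans ?_
    unfold subValue
    congr! 3 with e
    funext j
    rcases hi : σ (e j) with p | q
    · simp [combine, ← σ.symm_apply_eq.2 hi.symm]
    · simp [combine, hi]

theorem nonIidMax_le_adaptiveAddMax (η : unitInterval) (D : PMF X) (f : (Fin n → X) → Bool)
    (h : n ≤ m) :
    nonIidMax η (compSubsample f h) D ≤ adaptiveAddMax η (compSubsample f h) D := by
  have : Nonempty (NonIidStrategy X η m) := ⟨⟨iid D _, fun _ _ => arrangement η m⟩⟩
  refine ciSup_le fun s => ?_
  rw [successProb_eq, nonIidSample, pmfExpect_bind]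
  refine (pmfExpect_mono _ fun T => ?_).trans_eq (pmfExpect_const s.points _)
  rw [pmfExpect_map]
  refine pmfExpect_mono (iid D _) fun S => ?_
  exact le_ciSup (f := fun S' : addSample η m S => (compSubsample f h S' true).toReal)
    (Set.finite_range _).bddAbove ⟨combine S T (s.order S T), T, s.order S T, rfl⟩

theorem obliviousAddMax_le_nonIidMax (η : unitInterval) (D : PMF X) (f : (Fin n → X) → Bool)
    (h : n ≤ m) (hm : 0 < m) :
    obliviousAddMax η (deterministic f) D ≤
      nonIidMax η (compSubsample f h) D + ((n : ℝ) ^ 2 / m + 2 * n / m) := by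
  refine obliviousAddMax_le η D f fun E => ?_
  have hD := toReal_mem_stdSimplex D
  have hE := toReal_mem_stdSimplex E
  set P : Fin m → X → ℝ := fun i x =>
    Sum.elim (fun _ => (D x).toReal) (fun _ => (E x).toReal) (arrangement η m i) with hPdef
  have hP : ∀ i, P i ∈ stdSimplex ℝ X := fun i => by
    simp only [hPdef]
    cases arrangement η m i
    · exact hD
    · exact hE
  -- The adversary draws the added points from `E`.
  have h1 : successProb (nonIidSample D ⟨iid E _, fun _ _ => arrangement η m⟩)
      (compSubsample f h) = prodExpect P (subValue f) := by
    rw [successProb_eq, nonIidSample, pmfExpect_bind, pmfExpect_iid, prodExpect_combine]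
    simp only [pmfExpect_map, pmfExpect_iid, toReal_compSubsample]
  have h2 : successProb (nonIidSample D ⟨iid E _, fun _ _ => arrangement η m⟩)
      (compSubsample f h) ≤ nonIidMax η (compSubsample f h) D :=
    le_ciSup (f := fun s : NonIidStrategy X η m =>
      successProb (nonIidSample D s) (compSubsample f h))
      ⟨1, by rintro _ ⟨s, rfl⟩; exact successProb_le_one _ _⟩ _
  rw [h1, prodExpect_subValue fun i => (hP i).2] at h2
  have h3 := (abs_le.1 (abs_prodExpect_subsample_sub_le h hm hP (boolValue_mem_Icc f))).1
  have h4 := (abs_le.1 (abs_prodExpect_arrangement_sub_le η hm D hE f)).1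
  simp only [toReal_mix_apply]
  linarith

end Values

/-! ### The sample size -/

/-- The sample size bound, as a function of `n`, `e = 1 / ε` and `L = log |X|`. -/
theorem exists_small_fillError (X : Type*) [Fintype X] {n m : ℕ} {ε : ℝ} (hε : 0 < ε)
    (hε1 : ε < 1)
    (hm : n + 1 + 64 * ((n : ℝ) ^ 2 + n) * (1 / ε) + 256 * (n : ℝ) ^ 2 * (1 / ε) ^ 2 *
      ((8 * (n : ℝ) ^ 2 * (1 / ε) + 2) * Real.log (Fintype.card X) + 1) ≤ m) :
    n ≤ m ∧ 0 < m ∧ ∃ (k : ℕ) (t : ℝ), n ≤ k ∧ 0 < k ∧ 0 < t ∧ t * (2 * n / m) ≤ 1 ∧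
      (n : ℝ) ^ 2 / m + 2 * n / m + (2 * n / m + fillError X n m k t) ≤ ε := by
  have hn0 : (0 : ℝ) ≤ n := Nat.cast_nonneg n
  have hnn : (n : ℝ) ≤ (n : ℝ) ^ 2 := by exact_mod_cast Nat.le_self_pow two_ne_zero n
  set L := Real.log (Fintype.card X) with hL
  have hL0 : 0 ≤ L := Real.log_natCast_nonneg _
  have he1 : 1 ≤ 1 / ε := by rw [le_div_iff₀ hε]; linarith
  set e := 1 / ε with he
  have hee : e * ε = 1 := by rw [he]; field_simp
  have hA : 0 ≤ 64 * ((n : ℝ) ^ 2 + n) * e := by positivity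
  have hB : 0 ≤ 256 * (n : ℝ) ^ 2 * e ^ 2 * ((8 * (n : ℝ) ^ 2 * e + 2) * L + 1) := by positivity
  have hm1 : (n : ℝ) + 1 ≤ m := by linarith
  have hm0 : (0 : ℝ) < m := by linarith
  refine ⟨by exact_mod_cast (by linarith : (n : ℝ) ≤ m), by exact_mod_cast hm0,
    ⌈8 * (n : ℝ) ^ 2 * e⌉₊ + 1, 8 * e * ((⌈8 * (n : ℝ) ^ 2 * e⌉₊ + 1 : ℕ) * L + 1), ?_⟩
  have hk1 : 8 * (n : ℝ) ^ 2 * e ≤ (⌈8 * (n : ℝ) ^ 2 * e⌉₊ + 1 : ℕ) := by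
    push_cast
    linarith [Nat.le_ceil (8 * (n : ℝ) ^ 2 * e)]
  have hk2 : ((⌈8 * (n : ℝ) ^ 2 * e⌉₊ + 1 : ℕ) : ℝ) ≤ 8 * (n : ℝ) ^ 2 * e + 2 := by
    push_cast
    linarith [Nat.ceil_lt_add_one (show (0 : ℝ) ≤ 8 * (n : ℝ) ^ 2 * e by positivity)]
  have hk0 : 0 < ⌈8 * (n : ℝ) ^ 2 * e⌉₊ + 1 := Nat.succ_pos _
  generalize ⌈8 * (n : ℝ) ^ 2 * e⌉₊ + 1 = k at hk1 hk2 hk0 ⊢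
  have hk0' : (0 : ℝ) < k := by exact_mod_cast hk0
  set t := 8 * e * (k * L + 1) with ht
  have ht0 : 0 < t := by positivity
  -- The term of the sample size that controls the exponential moments.
  have hmt : 32 * (n : ℝ) ^ 2 * e * t ≤ m := by
    have h1 : (k : ℝ) * L ≤ (8 * (n : ℝ) ^ 2 * e + 2) * L := mul_le_mul_of_nonneg_right hk2 hL0
    calc 32 * (n : ℝ) ^ 2 * e * t = 256 * (n : ℝ) ^ 2 * e ^ 2 * (k * L + 1) := by rw [ht]; ring
      _ ≤ 256 * (n : ℝ) ^ 2 * e ^ 2 * ((8 * (n : ℝ) ^ 2 * e + 2) * L + 1) := by gcongr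
      _ ≤ m := by linarith
  refine ⟨?_, hk0, ht0, ?_, ?_⟩
  · have : (n : ℝ) ≤ k := by nlinarith
    exact_mod_cast this
  · rw [mul_div_assoc', div_le_one hm0]
    have h1 : (n : ℝ) * t ≤ (n : ℝ) ^ 2 * e * t := by
      refine mul_le_mul_of_nonneg_right ?_ ht0.le
      exact hnn.trans (le_mul_of_one_le_right (sq_nonneg _) he1)
    have h2 : 0 ≤ (n : ℝ) * t := by positivity
    nlinarith
  · have h1 : 4 * ((n : ℝ) ^ 2 + n) / m ≤ ε / 16 := by
      rw [div_le_iff₀ hm0]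
      have : 64 * ((n : ℝ) ^ 2 + n) * e * ε ≤ m * ε :=
        mul_le_mul_of_nonneg_right (by linarith) hε.le
      rw [mul_assoc _ e ε, hee] at this
      linarith
    have h2 : (n : ℝ) ^ 2 / k ≤ ε / 8 := by
      rw [div_le_iff₀ hk0']
      have := mul_le_mul_of_nonneg_right hk1 hε.le
      rw [mul_assoc _ e ε, hee] at this
      linarith
    have h3 : k * L / t ≤ ε / 8 := by
      rw [div_le_iff₀ ht0, ht]
      have : ε / 8 * (8 * e * (k * L + 1)) = e * ε * (k * L + 1) := by ring
      rw [this, hee]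
      linarith
    have h4 : t * (m * (2 * n / m) ^ 2) ≤ ε / 8 := by
      have : t * (m * (2 * n / m) ^ 2) = 4 * (n : ℝ) ^ 2 * t / m := by field_simp; ring
      rw [this, div_le_iff₀ hm0]
      have := mul_le_mul_of_nonneg_right hmt hε.le
      have h5 : 32 * (n : ℝ) ^ 2 * e * t * ε = 32 * (n : ℝ) ^ 2 * t * (e * ε) := by ring
      rw [h5, hee] at this
      linarith
    rw [fillError]
    have h6 : 4 * ((n : ℝ) ^ 2 + n) / m = (n : ℝ) ^ 2 / m + 2 * n / m + 2 * n / m +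
      3 * (n : ℝ) ^ 2 / m := by ring
    linarith

end AdditiveAdversary

theorem mainTheorem10 :
    ∃ p : MvPolynomial (Fin 3) ℝ,
      ∀ (X : Type*) [Fintype X] (n : ℕ) (f : (Fin n → X) → Bool) (D : PMF X)
        (η : unitInterval) (ε : ℝ), 0 < η → η < 1 → 0 < ε → ε < 1 →
        ∀ m : ℕ,
          MvPolynomial.eval ![(n : ℝ), 1 / ε, Real.log (Fintype.card X)] p ≤ (m : ℝ) →
          ∃ h : n ≤ m,
            let f' := AdditiveAdversary.compSubsample f h
            let v : Fin 4 → ℝ :=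
              ![AdditiveAdversary.obliviousAddMax η (AdditiveAdversary.deterministic f) D,
                AdditiveAdversary.adaptiveAddMax η f' D,
                AdditiveAdversary.malMax η f' D,
                AdditiveAdversary.nonIidMax η f' D]
            ∀ i j : Fin 4, |v i - v j| ≤ ε := by
  open AdditiveAdversary MvPolynomial in
  refine ⟨X 0 + 1 + 64 * (X 0 ^ 2 + X 0) * X 1 + 256 * X 0 ^ 2 * X 1 ^ 2 *
    ((8 * X 0 ^ 2 * X 1 + 2) * X 2 + 1), ?_⟩
  intro X _ n f D η ε _ _ hε hε1 m hp
  obtain ⟨hnm, hm, k, t, hnk, hk, ht, htm, herr⟩ :=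
    AdditiveAdversary.exists_small_fillError X (n := n) (m := m) hε hε1 (by simpa using hp)
  refine ⟨hnm, ?_⟩
  have hm' : (0 : ℝ) < m := by exact_mod_cast hm
  have h0 : 0 ≤ (n : ℝ) ^ 2 / m + 2 * n / m := by positivity
  have h0' : 0 ≤ 2 * (n : ℝ) / m := by positivity
  have hOM := AdditiveAdversary.obliviousAddMax_le_malMax η D f hnm
  have hON := AdditiveAdversary.obliviousAddMax_le_nonIidMax η D f hnm hm
  have hNA := AdditiveAdversary.nonIidMax_le_adaptiveAddMax η D f hnm
  have hAO := AdditiveAdversary.adaptiveAddMax_le η D f hnm hm hnk hk ht htm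
  have hMO := AdditiveAdversary.malMax_le η D f hnm hm hnk hk ht htm
  intro f' v i j
  rw [abs_le]
  fin_cases i <;> fin_cases j <;> simp only [v, f'] <;> constructor <;> simp <;> linarith
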